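/- Identify $T^*S^2$, via the round metric, with $\{(q,p)\in\mathbb R^3\times\mathbb R^3 : |q|=1,\ \langle q,p\rangle=0\}$; let $r=|p|$, let $\lambda=p\,dq$ be the standard Liouville form, $\Sigma(1)=ST^*S^2=\{r=1\}$ with contact form $\alpha=\lambda|_{\Sigma(1)}$, $\pi$ the projection to $S^2$ and $\sigma$ the area form of the round sphere $S^2$. The Liouville flow is $(q,p)\mapsto(q,e^sp)$. There is a smooth $\mathrm{SO}(3)$-invariant one-form $\Pi$ on $\Sigma(1)$ with $d\Pi=\pi^*\sigma$, and the Reeb flow $R_t$ of $\alpha$ is $2\pi$-periodic. For every $r_0>0$ there is $\delta>0$ such that the following holds for every such $\Pi$, extended to the complement of the zero section by radial projection, and every smooth function $f$ with $f(r)=1$ for $0\le r\le r_0$, $f(r)=0$ for all sufficiently large $r$, and $-\delta<f(r)f'(r)<\delta$ for all $r\ge 0$. Let $$\Omega=d(\lambda+f(r)\Pi)$$ off the zero section, extended over the zero section by $d\lambda+\pi^*\sigma$. Then $\Omega$ is a symplectic form on $T^*S^2$ which equals $d\lambda$ outside a compact set, and there is a Hamiltonian action $\varphi_t$, $t\in\mathbb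 R/\mathbb Z$, of the circle on $(T^*S^2,\Omega)$ (a smooth action whose generator $X$ satisfies $\Omega(-,X)=dK$ for a smooth function $K$ on $T^*S^2$) which commutes with the Liouville flow outside a compact set and whose ideal restriction to $ST^*S^2$, that is, the induced map on ends of Liouville trajectories, is the standard periodic Reeb flow $t\mapsto R_{2\pi t}$. In particular the loop $t\mapsto R_{2\pi t}$ is extensible in the filling $(T^*S^2,\Omega)$: it is the ideal restriction of a loop of Hamiltonian diffeomorphisms, based at the identity and generated by a smooth time-dependent Hamiltonian, that commutes with the Liouville flow outside a compact set. -/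

import Mathlib

open scoped ContDiff RealInnerProductSpace

noncomputable section

namespace MagneticSphere

/-! ### The cotangent bundle of the round two-sphere

`T*S²` is realised as the closed submanifold `{(q, p) : |q| = 1, ⟪q, p⟫ = 0}` of `ℝ³ × ℝ³`,
where `(q, p)` stands for the covector `⟪p, ·⟫` on `T_q S² = q^⊥` (musical isomorphism of the
round metric). A map on a submanifold `S` is smooth iff it is `ContDiffOn ℝ ∞` on `S`; a
differential form on a submanifold is represented by a form on the ambient space, of which only the
values on tangent vectors of the submanifold matter. -/

/-- Euclidean three-space. -/
abbrev E3 : Type := EuclideanSpace ℝ (Fin 3)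

/-- The ambient space `ℝ³ × ℝ³`, with points written `(q, p)` and vectors `(u, w)`. -/
abbrev V : Type := E3 × E3

/-- `T*S²`. -/
def cotangent : Set V := {x | ‖x.1‖ = 1 ∧ ⟪x.1, x.2⟫ = 0}

/-- The covector on `T_q S² = q^⊥` that the point `(q, p)` stands for. -/
def covector (x : V) : (ℝ ∙ x.1)ᗮ →L[ℝ] ℝ := (innerSL ℝ x.2).comp ((ℝ ∙ x.1)ᗮ).subtypeL

/-- Every covector on the sphere is represented by exactly one point of `cotangent`. -/
theorem existsUnique_covector (q : E3) (hq : ‖q‖ = 1) (ξ : (ℝ ∙ q)ᗮ →L[ℝ] ℝ) :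
    ∃! p : E3, (q, p) ∈ cotangent ∧ covector (q, p) = ξ := by
  let p₀ : (ℝ ∙ q)ᗮ := (InnerProductSpace.toDual ℝ (ℝ ∙ q)ᗮ).symm ξ
  have hp₀ : ∀ v, ⟪p₀, v⟫ = ξ v := fun v => InnerProductSpace.toDual_symm_apply
  refine ⟨(p₀ : E3), ⟨⟨hq, Submodule.mem_orthogonal_singleton_iff_inner_right.1 p₀.2⟩, ?_⟩, ?_⟩
  · ext v
    exact hp₀ v
  · rintro p ⟨⟨-, hp⟩, hξ⟩
    have hp' : p ∈ (ℝ ∙ q)ᗮ := Submodule.mem_orthogonal_singleton_iff_inner_right.2 hp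
    have : (⟨p, hp'⟩ : (ℝ ∙ q)ᗮ) = p₀ := by
      apply ext_inner_right ℝ
      intro v
      rw [hp₀ v, ← hξ]
      rfl
    exact congrArg Subtype.val this

/-- The tangent space `T_{(q,p)} T*S²`, the common kernel of the differentials of `|q|²` and
`⟪q, p⟫`. -/
def tangent (x : V) : Set V := {v | ⟪x.1, v.1⟫ = 0 ∧ ⟪v.1, x.2⟫ + ⟪x.1, v.2⟫ = 0}

/-- The unit cosphere bundle `Σ(1) = ST*S²`. -/
def cosphere : Set V := {x | x ∈ cotangent ∧ ‖x.2‖ = 1}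

/-- The tangent space of `ST*S²`. -/
def tangentCosphere (x : V) : Set V := {v | v ∈ tangent x ∧ ⟪x.2, v.2⟫ = 0}

/-- The radial projection `T*S² ∖ 0 → ST*S²`, `(q, p) ↦ (q, p / |p|)`. -/
def radialProj (x : V) : V := (x.1, ‖x.2‖⁻¹ • x.2)

/-- The Liouville flow `(q, p) ↦ (q, eˢ p)` of the standard Liouville form. -/
def liouvilleFlow (s : ℝ) (x : V) : V := (x.1, Real.exp s • x.2)

/-! ### Differential forms -/

/-- Differential `k`-forms, represented on the ambient space. -/
abbrev Form (k : ℕ) : Type := V → V [⋀^Fin k]→L[ℝ] ℝ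

/-- The pullback of a `k`-form. -/
def pullback {k : ℕ} (g : V → V) (η : Form k) : Form k :=
  fun x => (η (g x)).compContinuousLinearMap (fderiv ℝ g x)

/-- The standard Liouville form `λ = p dq`, that is `λ_{(q,p)}(u, w) = ⟪p, u⟫`. -/
def liouvilleForm : Form 1 := fun x =>
  ContinuousAlternatingMap.ofSubsingleton ℝ V ℝ (0 : Fin 1)
    ((innerSL ℝ x.2).comp (ContinuousLinearMap.fst ℝ E3 E3))

/-- The pullback `π^*σ` to `T*S²` of the area form `σ_q(u, u') = det (q, u, u')` of `S²`. -/
def areaForm : Form 2 := fun x =>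
  { toFun := fun v => Matrix.det (Matrix.of ![x.1.ofLp, (v 0).1.ofLp, (v 1).1.ofLp])
    map_update_add' := by
      intro _ v i a b
      fin_cases i <;> simp [Matrix.det_fin_three] <;> ring
    map_update_smul' := by
      intro _ v i c a
      fin_cases i <;> simp [Matrix.det_fin_three] <;> ring
    cont := by
      simp [Matrix.det_fin_three]
      fun_prop
    map_eq_zero_of_eq' := by
      intro v i j h hij
      have h01 : v 0 = v 1 := by
        fin_cases i <;> fin_cases j <;> simp_all
      simp [Matrix.det_fin_three, h01]
      ring }

/-- `P` is a smooth `SO(3)`-invariant one-form on `ST*S²` with `dP = π^*σ`. -/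
structure IsInvariantPrimitive (P : Form 1) : Prop where
  smooth : ContDiff ℝ ∞ P
  extDeriv_eq : ∀ x ∈ cosphere, ∀ v ∈ tangentCosphere x, ∀ w ∈ tangentCosphere x,
    extDeriv P x ![v, w] = areaForm x ![v, w]
  invariant : ∀ g : E3 ≃ₗᵢ[ℝ] E3, LinearMap.det (g.toLinearEquiv : E3 →ₗ[ℝ] E3) = 1 →
    ∀ x ∈ cosphere, ∀ v ∈ tangentCosphere x, P (g x.1, g x.2) ![(g v.1, g v.2)] = P x ![v]

/-- The one-form `λ + f(r) P` on the complement of the zero section, where `r = |p|` and `P` is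
extended by pulling back under the radial projection. -/
def magneticPrimitive (f : ℝ → ℝ) (P : Form 1) : Form 1 := fun x =>
  liouvilleForm x + f ‖x.2‖ • pullback radialProj P x

open Classical in
/-- The magnetic two-form `Ω = d(λ + f(r) P)`. On the zero section, where `f(r) = 1` and
`dP = π^*σ`, it is `dλ + π^*σ`. -/
def magneticForm (f : ℝ → ℝ) (P : Form 1) : Form 2 := fun x =>
  if x.2 = 0 then extDeriv liouvilleForm x + areaForm x else extDeriv (magneticPrimitive f P) x

/-- `Ω` is a symplectic form on `T*S²`. A form on a submanifold is smooth when it is locally the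
restriction of a smooth ambient form, and its exterior derivative is then the restriction of the
ambient exterior derivative. -/
structure IsSymplectic (Ω : Form 2) : Prop where
  smooth_closed : ∀ x ∈ cotangent, ∃ U : Set V, IsOpen U ∧ x ∈ U ∧ ∃ η : Form 2,
    ContDiffOn ℝ ∞ η U ∧
    (∀ y ∈ cotangent ∩ U, ∀ v : Fin 2 → V, (∀ i, v i ∈ tangent y) → η y v = Ω y v) ∧
    (∀ y ∈ cotangent ∩ U, ∀ v : Fin 3 → V, (∀ i, v i ∈ tangent y) → extDeriv η y v = 0)
  nondegenerate : ∀ x ∈ cotangent, ∀ v ∈ tangent x,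
    (∀ w ∈ tangent x, Ω x ![v, w] = 0) → v = 0

/-- `Ω` is the standard symplectic form `dλ` outside of a compact set. -/
def StandardAtInfinity (Ω : Form 2) : Prop :=
  ∃ ρ : ℝ, ∀ x ∈ cotangent, ρ ≤ ‖x.2‖ → ∀ v ∈ tangent x, ∀ w ∈ tangent x,
    Ω x ![v, w] = extDeriv liouvilleForm x ![v, w]

/-! ### Hamiltonian systems and their ideal restrictions -/

/-- `φ` is a smooth one-parameter family of self-maps of `T*S²` starting at the identity. -/
structure IsSmoothFamily (φ : ℝ → V → V) : Prop where
  smooth : ContDiffOn ℝ ∞ (fun z : ℝ × V => φ z.1 z.2) (Set.univ ×ˢ cotangent)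
  mapsTo : ∀ t, Set.MapsTo (φ t) cotangent cotangent
  zero : ∀ x ∈ cotangent, φ 0 x = x

/-- `φ` is generated by the time-dependent Hamiltonian `K`: `Ω(-, X_t) = dK_t` where
`X_t ∘ φ_t = ∂φ_t/∂t`. -/
def IsGeneratedBy (Ω : Form 2) (φ : ℝ → V → V) (K : ℝ → V → ℝ) : Prop :=
  ∀ t, ∀ x ∈ cotangent, ∀ v ∈ tangent (φ t x),
    Ω (φ t x) ![v, deriv (fun s => φ s x) t] = fderiv ℝ (K t) (φ t x) v

/-- `φ` is a Hamiltonian action of the circle `ℝ/ℤ`: a smooth action whose infinitesimal generator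
is the Hamiltonian vector field of a smooth (time-independent) function. -/
structure IsHamiltonianCircleAction (Ω : Form 2) (φ : ℝ → V → V) : Prop
    extends IsSmoothFamily φ where
  add : ∀ s t, ∀ x ∈ cotangent, φ (s + t) x = φ s (φ t x)
  one : ∀ x ∈ cotangent, φ 1 x = x
  hamiltonian : ∃ K : V → ℝ, ContDiff ℝ ∞ K ∧ IsGeneratedBy Ω φ (fun _ => K)

/-- `φ_t` commutes with the Liouville flow outside of a compact set. -/
def IsContactAtInfinity (φ : ℝ → V → V) : Prop :=
  ∃ ρ : ℝ, ∀ t, ∀ x ∈ cotangent, ρ ≤ ‖x.2‖ → ∀ s, 0 ≤ s →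
    φ t (liouvilleFlow s x) = liouvilleFlow s (φ t x)

/-- `ψ` is the ideal restriction of `φ` to the ideal boundary `ST*S²`, a point `y` of which is the
end of the Liouville trajectory through `y`. -/
def HasIdealRestriction (φ ψ : ℝ → V → V) : Prop :=
  ∃ s₀ : ℝ, ∀ t, ∀ y ∈ cosphere, ∀ s, s₀ ≤ s →
    radialProj (φ t (liouvilleFlow s y)) = ψ t y

/-- `φ` is a loop (of period `1`, based at the identity) of Hamiltonian diffeomorphisms,
generated by a smooth time-dependent Hamiltonian, which is contact-at-infinity. -/
structure IsContactHamiltonianLoop (Ω : Form 2) (φ : ℝ → V → V) : Prop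
    extends IsSmoothFamily φ where
  bijOn : ∀ t, Set.BijOn (φ t) cotangent cotangent
  periodic : ∀ t, ∀ x ∈ cotangent, φ (t + 1) x = φ t x
  hamiltonian : ∃ K : ℝ → V → ℝ, ContDiff ℝ ∞ (fun z : ℝ × V => K z.1 z.2) ∧
    IsGeneratedBy Ω φ K
  contactAtInfinity : IsContactAtInfinity φ

/-- The loop `ψ` on `ST*S²` is extensible in the filling `(T*S², Ω)`. -/
def IsExtensible (Ω : Form 2) (ψ : ℝ → V → V) : Prop :=
  ∃ φ : ℝ → V → V, IsContactHamiltonianLoop Ω φ ∧ HasIdealRestriction φ ψ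

/-- `R` is the flow of the Reeb vector field of the contact form `α = λ|_{ST*S²}`, that is the
vector field on which `α` is `1` and which spans the kernel of `dα`. -/
structure IsReebFlow (R : ℝ → V → V) : Prop where
  smooth : ContDiffOn ℝ ∞ (fun z : ℝ × V => R z.1 z.2) (Set.univ ×ˢ cosphere)
  mapsTo : ∀ t, Set.MapsTo (R t) cosphere cosphere
  zero : ∀ y ∈ cosphere, R 0 y = y
  add : ∀ s t, ∀ y ∈ cosphere, R (s + t) y = R s (R t y)
  form_eq_one : ∀ t, ∀ y ∈ cosphere, liouvilleForm (R t y) ![deriv (fun s => R s y) t] = 1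
  mem_ker : ∀ t, ∀ y ∈ cosphere, ∀ v ∈ tangentCosphere (R t y),
    extDeriv liouvilleForm (R t y) ![deriv (fun s => R s y) t, v] = 0

end MagneticSphere

end

/-! Everything is `SO(3)`-equivariant. The magnetic form has the invariant primitive `θ = λ + f(r)Π`
off the zero section. Hence evaluating `θ` on infinitesimal rotations gives a moment map for the
diagonal rotation action, namely `m = q × p - f(r) q`, and the generator of the rotations about a
unit vector `ξ` has Hamiltonian `⟪m, ξ⟫`. Taking `ξ = m / |m|` pointwise, the field that rotates
about the moment vector itself has Hamiltonian `|m|`. Equivariance keeps `m` fixed along that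
rotation, so all orbits close up after angle `2π`, and `2π|m|` generates a circle action.

The magnetic term is what makes this work across the zero section. There `|p|`, the Hamiltonian of
the normalised geodesic flow, is not smooth, whereas `|m| = √(r² + f²)` is smooth and positive
because `f = 1` near `r = 0`. Where `f = 0` the axis is `q × p / |p|`, and rotating about it is the
normalised geodesic flow, whose trace on the cosphere bundle is the Reeb flow.

Two facts carry the computation. `IsInvariantPrimitive.apply_eq` shows that every admissible `Π`
restricts to the same form on the cosphere bundle, since infinitesimal rotations span its tangent
spaces. This gives the explicit formula `magneticForm_apply`. From it, `nondegenerate_magneticForm`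
reduces nondegeneracy to `r + f f' > 0`, and `magneticForm_infRot` identifies the Hamiltonian. -/

namespace MagneticSphere

/-! ### The cross product and rotations of Euclidean three-space -/

/-- The cross product on `ℝ³` as a continuous bilinear map. -/
noncomputable def cross : E3 →L[ℝ] E3 →L[ℝ] E3 :=
  (LinearMap.mk₂ ℝ (fun a b : E3 => WithLp.toLp 2 (crossProduct a.ofLp b.ofLp))
    (by intros; simp) (by intros; simp) (by intros; simp)
    (by intros; simp)).toContinuousBilinearMap

theorem cross_apply_ofLp (a b : E3) :
    (cross a b).ofLp =
      ![a 1 * b 2 - a 2 * b 1, a 2 * b 0 - a 0 * b 2, a 0 * b 1 - a 1 * b 0] := by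
  simp [cross, cross_apply]

theorem inner_eq_sum_three (a b : E3) : ⟪a, b⟫ = a 0 * b 0 + a 1 * b 1 + a 2 * b 2 := by
  simp [PiLp.inner_apply, Fin.sum_univ_three, mul_comm]

theorem ext_three {a b : E3} (h0 : a 0 = b 0) (h1 : a 1 = b 1) (h2 : a 2 = b 2) : a = b := by
  ext i; fin_cases i <;> assumption

theorem cross_swap (a b : E3) : cross b a = -cross a b := by
  apply ext_three <;> simp [cross_apply_ofLp] <;> ring

@[simp] theorem cross_self_eq_zero (a : E3) : cross a a = 0 := by
  apply ext_three <;> simp [cross_apply_ofLp] <;> ring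

theorem inner_cross_rotate (a b c : E3) : ⟪cross a b, c⟫ = ⟪cross b c, a⟫ := by
  simp [inner_eq_sum_three, cross_apply_ofLp]; ring

@[simp] theorem inner_cross_self_left (a b : E3) : ⟪cross a b, a⟫ = 0 := by
  simp [inner_eq_sum_three, cross_apply_ofLp]; ring

@[simp] theorem inner_cross_self_right (a b : E3) : ⟪cross a b, b⟫ = 0 := by
  simp [inner_eq_sum_three, cross_apply_ofLp]; ring

@[simp] theorem inner_self_left_cross (a b : E3) : ⟪a, cross a b⟫ = 0 := by
  rw [real_inner_comm, inner_cross_self_left]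

@[simp] theorem inner_self_right_cross (a b : E3) : ⟪b, cross a b⟫ = 0 := by
  rw [real_inner_comm, inner_cross_self_right]

theorem cross_cross_right (a b c : E3) : cross a (cross b c) = ⟪a, c⟫ • b - ⟪a, b⟫ • c := by
  apply ext_three <;> simp [inner_eq_sum_three, cross_apply_ofLp] <;> ring

theorem cross_cross_left (a b c : E3) : cross (cross a b) c = ⟪a, c⟫ • b - ⟪b, c⟫ • a := by
  apply ext_three <;> simp [inner_eq_sum_three, cross_apply_ofLp] <;> ring

theorem inner_cross_cross (a b c d : E3) :
    ⟪cross a b, cross c d⟫ = ⟪a, c⟫ * ⟪b, d⟫ - ⟪a, d⟫ * ⟪b, c⟫ := by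
  simp [inner_eq_sum_three, cross_apply_ofLp]; ring

theorem det_eq_inner_cross (a b c : E3) :
    Matrix.det (Matrix.of ![a.ofLp, b.ofLp, c.ofLp]) = ⟪cross a b, c⟫ := by
  simp [Matrix.det_fin_three, inner_eq_sum_three, cross_apply_ofLp]; ring

theorem areaForm_apply (x v w : V) : areaForm x ![v, w] = ⟪cross x.1 v.1, w.1⟫ :=
  det_eq_inner_cross x.1 v.1 w.1

/-- A vector orthogonal to `q`, `p` and `q × p` vanishes when `q × p` does not. -/
theorem eq_zero_of_inner_eq_zero {q p a : E3} (h : cross q p ≠ 0) (hq : ⟪q, a⟫ = 0)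
    (hp : ⟪p, a⟫ = 0) (hm : ⟪cross q p, a⟫ = 0) : a = 0 := by
  have h0 : cross (cross q p) a = 0 := by rw [cross_cross_left, hq, hp]; simp
  have h1 := inner_cross_cross (cross q p) a (cross q p) a
  rw [h0, hm, inner_zero_left, zero_mul, sub_zero] at h1
  simpa [h] using h1.symm

/-- The triple product of three vectors in a common plane vanishes. -/
theorem inner_cross_eq_zero {q a b c : E3} (hq : q ≠ 0) (ha : ⟪q, a⟫ = 0) (hb : ⟪q, b⟫ = 0)
    (hc : ⟪q, c⟫ = 0) : ⟪cross a b, c⟫ = 0 := by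
  have h : cross q (cross a b) = 0 := by rw [cross_cross_right, ha, hb]; simp
  have h1 := inner_cross_cross q (cross a b) q c
  rw [h, inner_zero_left, hc] at h1
  simpa [hq] using h1.symm

/-- A linear map scales the triple product by its determinant. -/
theorem inner_cross_map (g : E3 →ₗ[ℝ] E3) (a b c : E3) :
    ⟪cross (g a) (g b), g c⟫ = LinearMap.det g * ⟪cross a b, c⟫ := by
  let e := EuclideanSpace.basisFun (Fin 3) ℝ
  have key : ∀ a b c : E3, ⟪cross a b, c⟫ = e.toBasis.det ![a, b, c] := by
    intro a b c
    rw [← det_eq_inner_cross, ← Matrix.det_transpose, Module.Basis.det_apply]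
    congr 1
    ext i j
    fin_cases j <;> simp [e, Module.Basis.toMatrix_apply]
  rw [key, key, ← Module.Basis.det_comp]
  congr 1
  ext i
  fin_cases i <;> simp

/-- The rotation by the angle `θ` about the unit vector `n`, by Rodrigues' formula. -/
noncomputable def rot (n : E3) (θ : ℝ) : E3 →L[ℝ] E3 :=
  Real.cos θ • ContinuousLinearMap.id ℝ E3 + Real.sin θ • cross n +
    (1 - Real.cos θ) • (innerSL ℝ n).smulRight n

theorem rot_apply (n : E3) (θ : ℝ) (v : E3) :
    rot n θ v = Real.cos θ • v + Real.sin θ • cross n v + ((1 - Real.cos θ) * ⟪n, v⟫) • n := by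
  simp [rot, smul_smul]

@[simp] theorem rot_zero (n v : E3) : rot n 0 v = v := by simp [rot_apply]

theorem rot_add {n : E3} (hn : ‖n‖ = 1) (s t : ℝ) (v : E3) :
    rot n (s + t) v = rot n s (rot n t v) := by
  have hnn : ⟪n, n⟫ = 1 := by simp [hn]
  have h : ⟪n, rot n t v⟫ = ⟪n, v⟫ := by
    simp only [rot_apply, inner_add_right, real_inner_smul_right, inner_self_left_cross, hnn]
    ring
  rw [rot_apply n s, h]
  simp only [rot_apply, Real.cos_add, Real.sin_add, map_add, map_smul, cross_cross_right, hnn,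
    cross_self_eq_zero]
  module

theorem rot_self {n : E3} (hn : ‖n‖ = 1) (t : ℝ) : rot n t n = n := by
  have hnn : ⟪n, n⟫ = 1 := by simp [hn]
  simp only [rot_apply, cross_self_eq_zero, hnn]
  module

theorem rot_two_pi (n v : E3) : rot n (2 * Real.pi) v = v := by
  simp [rot_apply]

theorem inner_rot_rot {n : E3} (hn : ‖n‖ = 1) (t : ℝ) (v w : E3) :
    ⟪rot n t v, rot n t w⟫ = ⟪v, w⟫ := by
  have hnn : ⟪n, n⟫ = 1 := by simp [hn]
  have h1 : ⟪v, cross n w⟫ = -⟪cross n v, w⟫ := by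
    rw [real_inner_comm, inner_cross_rotate, inner_cross_rotate, cross_swap, inner_neg_left]
  simp only [rot_apply, inner_add_left, inner_add_right, inner_smul_left, inner_smul_right,
    inner_cross_cross, inner_self_left_cross, inner_cross_self_left, hnn, h1,
    real_inner_comm n v]
  simp
  linear_combination (⟪v, w⟫ - ⟪n, v⟫ * ⟪n, w⟫) * Real.sin_sq_add_cos_sq t

theorem norm_rot {n : E3} (hn : ‖n‖ = 1) (t : ℝ) (v : E3) : ‖rot n t v‖ = ‖v‖ := by
  have h := inner_rot_rot hn t v v
  rw [real_inner_self_eq_norm_sq, real_inner_self_eq_norm_sq] at h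
  exact (sq_eq_sq₀ (norm_nonneg _) (norm_nonneg _)).1 h

theorem hasDerivAt_rot (n : E3) (t : ℝ) (v : E3) :
    HasDerivAt (fun s => rot n s v)
      (-Real.sin t • v + Real.cos t • cross n v + (Real.sin t * ⟪n, v⟫) • n) t := by
  simp only [rot_apply]
  have h1 := Real.hasDerivAt_cos t
  have h2 := Real.hasDerivAt_sin t
  have h3 := ((h1.const_sub 1).mul_const ⟪n, v⟫).smul_const n
  simpa using ((h1.smul_const v).fun_add (h2.smul_const (cross n v))).fun_add h3

theorem hasDerivAt_rot_eq_cross {n : E3} (hn : ‖n‖ = 1) (t : ℝ) (v : E3) :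
    HasDerivAt (fun s => rot n s v) (cross n (rot n t v)) t := by
  have hnn : ⟪n, n⟫ = 1 := by simp [hn]
  convert hasDerivAt_rot n t v using 1
  simp only [rot_apply, map_add, map_smul, cross_cross_right, cross_self_eq_zero, hnn]
  module

/-- Rotation about a unit vector, as a linear isometry. -/
noncomputable def rotIsometry (n : E3) (hn : ‖n‖ = 1) (t : ℝ) : E3 ≃ₗᵢ[ℝ] E3 :=
  LinearIsometry.toLinearIsometryEquiv ⟨(rot n t).toLinearMap, norm_rot hn t⟩ rfl

@[simp] theorem rotIsometry_apply (n : E3) (hn : ‖n‖ = 1) (t : ℝ) (v : E3) :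
    rotIsometry n hn t v = rot n t v := rfl

/-- The determinant of an isometry is `±1`, and a rotation is the square of the rotation by half the
angle. -/
theorem det_rot {n : E3} (hn : ‖n‖ = 1) (t : ℝ) :
    LinearMap.det (rot n t).toLinearMap = 1 := by
  have hcomp : (rot n t).toLinearMap =
      (rot n (t / 2)).toLinearMap * (rot n (t / 2)).toLinearMap := by
    ext1 v
    have := rot_add hn (t / 2) (t / 2) v
    rw [add_halves] at this
    simpa using this
  have hab : |LinearMap.det (rot n (t / 2)).toLinearMap| = 1 := by
    rw [← Real.norm_eq_abs, ← LinearMap.normDet_eq_norm_det]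
    exact (rotIsometry n hn (t / 2)).toLinearIsometry.normDet_eq_one
  rw [hcomp, map_mul, ← abs_mul_abs_self, hab, one_mul]

/-- Rotations preserve inner and triple products, so both sides pair equally with every rotated
vector, and these exhaust the space. -/
theorem cross_rot_rot {n : E3} (hn : ‖n‖ = 1) (t : ℝ) (a b : E3) :
    cross (rot n t a) (rot n t b) = rot n t (cross a b) := by
  apply ext_inner_right ℝ
  intro c
  obtain ⟨c, rfl⟩ := (rotIsometry n hn t).surjective c
  rw [rotIsometry_apply, inner_rot_rot hn]
  simpa [det_rot hn] using inner_cross_map (rot n t).toLinearMap a b c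

/-! ### Calculus of differential forms -/

/-- Covectors of the ambient space as alternating one-forms. -/
noncomputable abbrev oneForm : (V →L[ℝ] ℝ) ≃ₗᵢ[ℝ] V [⋀^Fin 1]→L[ℝ] ℝ :=
  ContinuousAlternatingMap.ofSubsingletonLIE (𝕜 := ℝ) (E := V) (F := ℝ) (0 : Fin 1)

theorem oneForm_apply (L : V →L[ℝ] ℝ) (v : V) : oneForm L ![v] = L v := by
  simp [oneForm]

theorem oneForm_symm_apply (η : V [⋀^Fin 1]→L[ℝ] ℝ) (v : V) : oneForm.symm η v = η ![v] := by
  rw [← oneForm_apply, LinearIsometryEquiv.apply_symm_apply]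

theorem contDiff_one_of_apply {η : Form 1} (h : ∀ v, ContDiff ℝ ∞ fun x => η x ![v]) :
    ContDiff ℝ ∞ η := by
  have h1 : ContDiff ℝ ∞ fun x => oneForm.symm (η x) := by
    rw [contDiff_clm_apply_iff]
    intro v
    simpa only [oneForm_symm_apply] using h v
  have h2 := oneForm.contDiff.comp h1
  rwa [show oneForm ∘ (fun x => oneForm.symm (η x)) = η from
    funext fun x => oneForm.apply_symm_apply (η x)] at h2

theorem liouvilleForm_apply (x v : V) : liouvilleForm x ![v] = ⟪x.2, v.1⟫ :=
  oneForm_apply _ v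

theorem contDiff_liouvilleForm : ContDiff ℝ ∞ liouvilleForm := by
  refine contDiff_one_of_apply fun v => ?_
  simp only [liouvilleForm_apply]
  exact contDiff_snd.inner ℝ contDiff_const

theorem areaForm_apply_eq (x : V) (v : Fin 2 → V) :
    areaForm x v = ⟪cross x.1 (v 0).1, (v 1).1⟫ :=
  det_eq_inner_cross x.1 (v 0).1 (v 1).1

/-- The form `areaForm` depends linearly on the base point. -/
noncomputable def areaFormCLM : V →L[ℝ] V [⋀^Fin 2]→L[ℝ] ℝ :=
  LinearMap.toContinuousLinearMap
    { toFun := areaForm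
      map_add' := by
        intro x y
        ext v
        simp [areaForm_apply_eq, inner_add_left]
      map_smul' := by
        intro c x
        ext v
        simp [areaForm_apply_eq, real_inner_smul_left] }

theorem coe_areaFormCLM : ⇑areaFormCLM = areaForm := rfl

theorem contDiff_areaForm : ContDiff ℝ ∞ areaForm := areaFormCLM.contDiff

/-- The ambient extension is not closed. Its derivative vanishes on tangent vectors because each
term is a triple product of three vectors in the plane `q^⊥`. -/
theorem extDeriv_areaForm_apply {x : V} (hx : x ∈ cotangent) (v : Fin 3 → V)
    (hv : ∀ i, v i ∈ tangent x) : extDeriv areaForm x v = 0 := by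
  have hq : x.1 ≠ 0 := by
    intro h
    simpa [h] using hx.1
  rw [extDeriv, ContinuousAlternatingMap.alternatizeUncurryFin_apply, ← coe_areaFormCLM,
    ContinuousLinearMap.fderiv, coe_areaFormCLM]
  refine Finset.sum_eq_zero fun i _ => ?_
  have h : ∀ j, ⟪x.1, (i.removeNth v j).1⟫ = 0 := fun j => (hv _).1
  rw [areaForm_apply_eq, inner_cross_eq_zero hq (hv i).1 (h 0) (h 1), smul_zero]

theorem extDeriv_one_apply {η : Form 1} {x : V} (v w : V) :
    extDeriv η x ![v, w] = fderiv ℝ η x v ![w] - fderiv ℝ η x w ![v] := by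
  have h0 : (Fin.removeNth 0 ![v, w] : Fin 1 → V) = ![w] := by
    ext1 i; fin_cases i; rfl
  have h1 : (Fin.removeNth 1 ![v, w] : Fin 1 → V) = ![v] := by
    ext1 i; fin_cases i; rfl
  rw [extDeriv, ContinuousAlternatingMap.alternatizeUncurryFin_apply]
  simp [Fin.sum_univ_two, h0, h1, sub_eq_add_neg]

theorem fderiv_form_apply {k : ℕ} {η : Form k} {x : V} (h : DifferentiableAt ℝ η x)
    (v : V) (w : Fin k → V) : fderiv ℝ η x v w = fderiv ℝ (fun y => η y w) x v :=
  (fderiv_continuousAlternatingMap_apply_const_apply h w v).symm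

theorem extDeriv_liouvilleForm (x v w : V) :
    extDeriv liouvilleForm x ![v, w] = ⟪v.2, w.1⟫ - ⟪w.2, v.1⟫ := by
  have h : DifferentiableAt ℝ liouvilleForm x :=
    contDiff_liouvilleForm.differentiable (by simp) x
  have key : ∀ v w : V, fderiv ℝ liouvilleForm x v ![w] = ⟪v.2, w.1⟫ := by
    intro v w
    rw [fderiv_form_apply h]
    have : (fun y => liouvilleForm y ![w]) =
        ((innerSL ℝ w.1).comp (ContinuousLinearMap.snd ℝ E3 E3)) := by
      ext y
      simp [liouvilleForm_apply, real_inner_comm]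
    rw [this, ContinuousLinearMap.fderiv]
    simp [real_inner_comm]
  rw [extDeriv_one_apply, key, key]

theorem contDiff_extDeriv {k : ℕ} {η : Form k} {U : Set V} (hU : IsOpen U)
    (h : ContDiffOn ℝ ∞ η U) : ContDiffOn ℝ ∞ (extDeriv η) U :=
  (ContinuousAlternatingMap.alternatizeUncurryFinCLM ℝ V ℝ).contDiff.comp_contDiffOn
    (h.fderiv_of_isOpen hU (by simp))

theorem contDiffOn_pullback_one {g : V → V} {η : Form 1} {U : Set V} (hU : IsOpen U)
    (hη : ContDiff ℝ ∞ η) (hg : ContDiffOn ℝ ∞ g U) : ContDiffOn ℝ ∞ (pullback g η) U := by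
  have h : pullback g η = fun x =>
      oneForm ((oneForm.symm (η (g x))).comp (fderiv ℝ g x)) := by
    funext x
    ext v
    simp [pullback, oneForm]
    congr 1
    ext1 i
    fin_cases i
    rfl
  rw [h]
  refine oneForm.contDiff.comp_contDiffOn ?_
  exact (oneForm.symm.contDiff.comp_contDiffOn (hη.comp_contDiffOn hg)).clm_comp
    (hg.fderiv_of_isOpen hU (by simp))

theorem extDeriv_smul_function {g : V → ℝ} {η : Form 1} {x : V} (hg : DifferentiableAt ℝ g x)
    (hη : DifferentiableAt ℝ η x) (v w : V) :
    extDeriv (fun y => g y • η y) x ![v, w] =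
      fderiv ℝ g x v * η x ![w] - fderiv ℝ g x w * η x ![v] + g x * extDeriv η x ![v, w] := by
  have h : fderiv ℝ (fun y => g y • η y) x = g x • fderiv ℝ η x + (fderiv ℝ g x).smulRight (η x) :=
    fderiv_fun_smul hg hη
  rw [extDeriv_one_apply, extDeriv_one_apply, h]
  simp
  ring

/-! ### The cotangent bundle away from the zero section -/

theorem isOpen_snd_ne_zero : IsOpen {x : V | x.2 ≠ 0} :=
  isOpen_ne_fun continuous_snd continuous_const

theorem contDiffAt_norm_snd {x : V} (hx : x.2 ≠ 0) :
    ContDiffAt ℝ ∞ (fun y : V => ‖y.2‖) x :=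
  contDiffAt_snd.norm ℝ hx

theorem fderiv_norm_snd {x : V} (hx : x.2 ≠ 0) (v : V) :
    fderiv ℝ (fun y : V => ‖y.2‖) x v = ⟪x.2, v.2⟫ / ‖x.2‖ := by
  have h1 : HasFDerivAt (fun y : V => ‖y.2‖ ^ 2)
      (2 • (innerSL ℝ x.2).comp (ContinuousLinearMap.snd ℝ E3 E3)) x :=
    hasFDerivAt_snd.norm_sq
  have h2 := ((contDiffAt_norm_snd hx).differentiableAt (by simp)).hasFDerivAt.pow 2
  have h3 := congrArg (fun L => L v) (h1.unique h2)
  have hn : ‖x.2‖ ≠ 0 := norm_ne_zero_iff.2 hx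
  simp at h3
  field_simp
  linarith

theorem contDiffOn_radialProj : ContDiffOn ℝ ∞ radialProj {x : V | x.2 ≠ 0} := by
  intro x hx
  refine ContDiffAt.contDiffWithinAt ?_
  exact contDiffAt_fst.prodMk
    (((contDiffAt_norm_snd hx).inv (norm_ne_zero_iff.2 hx)).smul contDiffAt_snd)

theorem fderiv_radialProj {x : V} (hx : x.2 ≠ 0) (v : V) :
    fderiv ℝ radialProj x v =
      (v.1, ‖x.2‖⁻¹ • v.2 - (⟪x.2, v.2⟫ / ‖x.2‖ ^ 3) • x.2) := by
  have hn : ‖x.2‖ ≠ 0 := norm_ne_zero_iff.2 hx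
  have h1 := ((contDiffAt_norm_snd hx).differentiableAt (by simp)).hasFDerivAt
  have h2 := ((hasDerivAt_inv hn).comp_hasFDerivAt x h1).smul
    (hasFDerivAt_snd (𝕜 := ℝ) (E := E3) (F := E3) (p := x))
  have h3 : HasFDerivAt radialProj _ x :=
    (hasFDerivAt_fst (𝕜 := ℝ) (E := E3) (F := E3) (p := x)).prodMk h2
  rw [h3.fderiv]
  simp [fderiv_norm_snd hx]
  rw [sub_eq_add_neg, ← neg_smul, ← neg_smul]
  congr 2
  field_simp

theorem radialProj_mem_cosphere {x : V} (hx : x ∈ cotangent) (h0 : x.2 ≠ 0) :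
    radialProj x ∈ cosphere := by
  have hn : ‖x.2‖ ≠ 0 := norm_ne_zero_iff.2 h0
  refine ⟨⟨hx.1, ?_⟩, ?_⟩
  · simp [radialProj, inner_smul_right, hx.2]
  · simp [radialProj, norm_smul, hn]

theorem fderiv_radialProj_mem {x v : V} (hx : x ∈ cotangent) (h0 : x.2 ≠ 0)
    (hv : v ∈ tangent x) : fderiv ℝ radialProj x v ∈ tangentCosphere (radialProj x) := by
  have hn : ‖x.2‖ ≠ 0 := norm_ne_zero_iff.2 h0
  rw [fderiv_radialProj h0]
  refine ⟨⟨hv.1, ?_⟩, ?_⟩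
  · simp [radialProj, inner_smul_right, inner_sub_right, hx.2]
    rw [← mul_add, hv.2, mul_zero]
  · simp [radialProj, inner_smul_right, inner_smul_left, inner_sub_right]
    field_simp
    ring

/-! ### Invariant primitives of the area form on the cosphere bundle -/

/-- The infinitesimal diagonal action of `ξ ∈ so(3) = ℝ³` on `ℝ³ × ℝ³`. -/
noncomputable def infRot (ξ : E3) (x : V) : V := (cross ξ x.1, cross ξ x.2)

theorem infRot_mem (x : V) (ξ : E3) : infRot ξ x ∈ tangentCosphere x := by
  refine ⟨⟨?_, ?_⟩, ?_⟩
  · simp [infRot]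
  · simp only [infRot]
    rw [inner_cross_rotate, inner_cross_rotate, real_inner_comm (cross ξ x.2), inner_cross_rotate,
      cross_swap x.1, inner_neg_left, inner_cross_rotate, inner_cross_rotate]
    simp
  · simp [infRot]

/-- `SO(3)` acts simply transitively on the cosphere bundle, so infinitesimal rotations fill its
tangent spaces. The coefficients come from pairing with the orthonormal frame `q`, `p`, `q × p`. -/
theorem exists_eq_infRot {x v : V} (hx : x ∈ cosphere) (hv : v ∈ tangentCosphere x) :
    v = infRot (⟪cross x.1 x.2, v.2⟫ • x.1 - ⟪cross x.1 x.2, v.1⟫ • x.2 +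
      ⟪x.2, v.1⟫ • cross x.1 x.2) x := by
  obtain ⟨⟨h1, h0⟩, h2⟩ := hx
  obtain ⟨⟨h3, h4⟩, h5⟩ := hv
  have hm : cross x.1 x.2 ≠ 0 := by
    intro h
    have := inner_cross_cross x.1 x.2 x.1 x.2
    simp [h, h0, h1, h2] at this
  have h11 : ⟪x.1, x.1⟫ = 1 := by simp [h1]
  have h22 : ⟪x.2, x.2⟫ = 1 := by simp [h2]
  have h21 : ⟪x.2, x.1⟫ = 0 := by rw [real_inner_comm, h0]
  have hmm : ⟪cross x.1 x.2, cross x.1 x.2⟫ = 1 := by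
    rw [inner_cross_cross, h11, h22, h0]; simp
  rw [real_inner_comm] at h4
  ext1 <;> rw [← sub_eq_zero] <;> apply eq_zero_of_inner_eq_zero hm <;>
    simp only [infRot, map_add, map_sub, map_smul, add_apply, sub_apply, smul_apply,
      cross_cross_left, cross_self_eq_zero, inner_sub_right, inner_add_right,
      real_inner_smul_right, h0, h11, h22, h21, h3, h5, smul_zero, zero_smul,
      inner_self_left_cross, inner_self_right_cross, inner_cross_self_left,
      inner_cross_self_right, inner_zero_right, hmm, cross_swap x.1 x.2, inner_neg_right]
  all_goals linarith

theorem inner_cross_infRot (q ξ η : E3) :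
    ⟪cross q (cross ξ q), cross η q⟫ = ⟪q, q⟫ * ⟪q, cross ξ η⟫ := by
  simp only [inner_eq_sum_three, cross_apply_ofLp, Matrix.cons_val]
  ring

theorem areaForm_infRot {x : V} (hx : ‖x.1‖ = 1) (ξ η : E3) :
    areaForm x ![infRot ξ x, infRot η x] = ⟪x.1, cross ξ η⟫ := by
  rw [areaForm_apply]
  simp [infRot, inner_cross_infRot, hx]

/-- The invariant primitive `-⟪q × p, w⟫` of the area form: minus the connection form of the
circle bundle `ST*S² → S²`. -/
noncomputable def connectionForm : Form 1 := fun x =>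
  oneForm (-(innerSL ℝ (cross x.1 x.2)).comp (ContinuousLinearMap.snd ℝ E3 E3))

theorem connectionForm_apply (x v : V) : connectionForm x ![v] = -⟪cross x.1 x.2, v.2⟫ :=
  oneForm_apply _ v

theorem contDiff_cross {E : Type*} [NormedAddCommGroup E] [NormedSpace ℝ E] {f g : E → E3}
    (hf : ContDiff ℝ ∞ f) (hg : ContDiff ℝ ∞ g) : ContDiff ℝ ∞ fun x => cross (f x) (g x) :=
  (cross.contDiff.comp hf).clm_apply hg

theorem contDiff_connectionForm : ContDiff ℝ ∞ connectionForm := by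
  refine contDiff_one_of_apply fun v => ?_
  simp only [connectionForm_apply]
  exact ((contDiff_cross contDiff_fst contDiff_snd).inner ℝ contDiff_const).neg

theorem fderiv_connectionForm (x v w : V) :
    fderiv ℝ connectionForm x v ![w] = -⟪cross v.1 x.2 + cross x.1 v.2, w.2⟫ := by
  rw [fderiv_form_apply (contDiff_connectionForm.differentiable (by simp) x)]
  simp only [connectionForm_apply]
  have h1 : HasFDerivAt (fun y : V => cross y.1 y.2) _ x :=
    cross.hasFDerivAt_of_bilinear (hasFDerivAt_fst (𝕜 := ℝ) (E := E3) (F := E3) (p := x))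
      hasFDerivAt_snd
  have h2 := (h1.inner ℝ (hasFDerivAt_const w.2 x)).fun_neg
  rw [h2.fderiv]
  simp [add_comm]

theorem isInvariantPrimitive_connectionForm : IsInvariantPrimitive connectionForm where
  smooth := contDiff_connectionForm
  extDeriv_eq := by
    intro x hx v hv w hw
    have h11 : ⟪x.1, x.1⟫ = 1 := by simp [hx.1.1]
    have h22 : ⟪x.2, x.2⟫ = 1 := by simp [hx.2]
    -- Jacobi identity: `ξ ×` is a derivation of the cross product.
    have key : ∀ ξ, cross (cross ξ x.1) x.2 + cross x.1 (cross ξ x.2) = cross ξ (cross x.1 x.2) := by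
      intro ξ
      simp only [cross_cross_left, cross_cross_right, hx.1.2, real_inner_comm ξ]
      module
    have hpm : cross x.2 (cross x.1 x.2) = x.1 := by
      rw [cross_cross_right, real_inner_comm x.1, hx.1.2, h22]; simp
    rw [exists_eq_infRot hx hv, exists_eq_infRot hx hw]
    generalize ⟪cross x.1 x.2, v.2⟫ • x.1 - ⟪cross x.1 x.2, v.1⟫ • x.2 +
      ⟪x.2, v.1⟫ • cross x.1 x.2 = ξ
    generalize ⟪cross x.1 x.2, w.2⟫ • x.1 - ⟪cross x.1 x.2, w.1⟫ • x.2 +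
      ⟪x.2, w.1⟫ • cross x.1 x.2 = η
    -- Since `p × (q × p) = q`, this expands the area form `⟪q, ξ × η⟫` into the products that also
    -- arise from `dP`.
    have h := inner_cross_cross x.2 (cross x.1 x.2) ξ η
    rw [hpm] at h
    rw [areaForm_infRot hx.1.1, extDeriv_one_apply, fderiv_connectionForm, fderiv_connectionForm, h]
    simp only [infRot, key, inner_cross_cross, inner_cross_self_right, real_inner_comm ξ η,
      real_inner_comm ξ x.2, real_inner_comm η (cross x.1 x.2), real_inner_comm η x.2,
      real_inner_comm ξ (cross x.1 x.2)]
    ring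
  invariant := by
    intro g hg x hx v hv
    have h := inner_cross_map (g.toLinearEquiv : E3 →ₗ[ℝ] E3) x.1 x.2 v.2
    rw [hg, one_mul] at h
    rw [connectionForm_apply, connectionForm_apply, ← h]
    rfl

theorem hasDerivAt_rot_zero {n : E3} (hn : ‖n‖ = 1) (v : E3) :
    HasDerivAt (fun s => rot n s v) (cross n v) 0 := by
  simpa using hasDerivAt_rot_eq_cross hn 0 v

/-- The Lie derivative of an invariant primitive along an infinitesimal rotation vanishes. -/
theorem IsInvariantPrimitive.fderiv_infRot {P : Form 1} (hP : IsInvariantPrimitive P) {x : V}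
    (hx : x ∈ cosphere) {v : V} (hv : v ∈ tangentCosphere x) {ξ : E3} (hξ : ‖ξ‖ = 1) :
    fderiv ℝ P x (infRot ξ x) ![v] + P x ![infRot ξ v] = 0 := by
  have hγ : ∀ y : V, HasDerivAt (fun s => ((rot ξ s y.1, rot ξ s y.2) : V)) (infRot ξ y) 0 :=
    fun y => (hasDerivAt_rot_zero hξ y.1).prodMk (hasDerivAt_rot_zero hξ y.2)
  have h0 : ∀ y : V, ((rot ξ 0 y.1, rot ξ 0 y.2) : V) = y := by simp
  have hQ : DifferentiableAt ℝ (fun y => oneForm.symm (P y)) x :=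
    (oneForm.symm.contDiff.comp hP.smooth).differentiable (by simp) x
  have h1 : HasDerivAt (fun s => oneForm.symm (P (rot ξ s x.1, rot ξ s x.2)))
      (fderiv ℝ (fun y => oneForm.symm (P y)) x (infRot ξ x)) 0 := by
    have := hQ.hasFDerivAt
    rw [← h0 x] at this
    have h := this.comp_hasDerivAt (0 : ℝ) (hγ x)
    rwa [h0] at h
  have h2 := h1.clm_apply (hγ v)
  -- By invariance the pairing is constant along the rotation, so its derivative from the product
  -- rule is zero.
  have h3 : (fun s => oneForm.symm (P (rot ξ s x.1, rot ξ s x.2)) (rot ξ s v.1, rot ξ s v.2)) =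
      fun _ => P x ![v] := by
    funext s
    rw [oneForm_symm_apply]
    exact hP.invariant (rotIsometry ξ hξ s) (det_rot hξ s) x hx v hv
  have h5 := h2.unique (h3 ▸ hasDerivAt_const (0 : ℝ) (P x ![v]))
  have h6 : fderiv ℝ (fun y => oneForm.symm (P y)) x (infRot ξ x) v =
      fderiv ℝ P x (infRot ξ x) ![v] := by
    rw [← oneForm_symm_apply]
    have := oneForm.symm.toContinuousLinearEquiv.comp_fderiv (f := P) (x := x)
    exact congrArg (fun L => L (infRot ξ x) v) this
  rw [h0, h0, h6, oneForm_symm_apply] at h5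
  exact h5

/-- Invariance turns both derivative terms of `dP` on two infinitesimal rotations into values of
`P`, which combine to minus the value on the commutator. The condition `dP = π^*σ` then determines
`P` there. -/
theorem IsInvariantPrimitive.apply_infRot_cross {P : Form 1} (hP : IsInvariantPrimitive P) {x : V}
    (hx : x ∈ cosphere) {ξ η : E3} (hξ : ‖ξ‖ = 1) (hη : ‖η‖ = 1) :
    P x ![infRot (cross ξ η) x] = -⟪x.1, cross ξ η⟫ := by
  have h1 := hP.fderiv_infRot hx (infRot_mem x η) hξ
  have h2 := hP.fderiv_infRot hx (infRot_mem x ξ) hη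
  have h3 := hP.extDeriv_eq x hx _ (infRot_mem x ξ) _ (infRot_mem x η)
  rw [areaForm_infRot hx.1.1, extDeriv_one_apply] at h3
  have h4 : infRot (cross ξ η) x = infRot ξ (infRot η x) - infRot η (infRot ξ x) := by
    have key : ∀ a, cross (cross ξ η) a = cross ξ (cross η a) - cross η (cross ξ a) := by
      intro a
      simp only [cross_cross_left, cross_cross_right, real_inner_comm ξ η]
      module
    simp [infRot, key]
  rw [h4, ← oneForm_symm_apply, map_sub, oneForm_symm_apply, oneForm_symm_apply]
  linarith

/-- An invariant primitive restricts to the connection form on the cosphere bundle. -/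
theorem IsInvariantPrimitive.apply_eq {P : Form 1} (hP : IsInvariantPrimitive P) {x v : V}
    (hx : x ∈ cosphere) (hv : v ∈ tangentCosphere x) : P x ![v] = -⟪cross x.1 x.2, v.2⟫ := by
  have h11 : ⟪x.1, x.1⟫ = 1 := by simp [hx.1.1]
  have h22 : ⟪x.2, x.2⟫ = 1 := by simp [hx.2]
  have h21 : ⟪x.2, x.1⟫ = 0 := by rw [real_inner_comm, hx.1.2]
  have hm : ‖cross x.1 x.2‖ = 1 := by
    have : ⟪cross x.1 x.2, cross x.1 x.2⟫ = 1 := by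
      rw [inner_cross_cross, h11, h22, h21]; simp
    rwa [real_inner_self_eq_norm_sq, pow_eq_one_iff_of_nonneg (norm_nonneg _) two_ne_zero] at this
  -- Each vector of the frame `q`, `p`, `q × p` is a cross product of the other two, so `P` is known
  -- on a basis.
  have hq := hP.apply_infRot_cross hx hx.2 hm
  have hp := hP.apply_infRot_cross hx hm hx.1.1
  have hqp := hP.apply_infRot_cross hx hx.1.1 hx.2
  rw [cross_cross_right, h22, h21, zero_smul, sub_zero, one_smul, h11] at hq
  rw [cross_cross_left, h11, h21, zero_smul, sub_zero, one_smul, hx.1.2] at hp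
  rw [inner_self_left_cross] at hqp
  have hlin : ∀ (a b c : ℝ), infRot (a • x.1 - b • x.2 + c • cross x.1 x.2) x =
      a • infRot x.1 x - b • infRot x.2 x + c • infRot (cross x.1 x.2) x := by
    intro a b c
    simp [infRot]
  rw [← oneForm_symm_apply] at hq hp hqp ⊢
  conv_lhs => rw [exists_eq_infRot hx hv]
  rw [hlin, map_add, map_sub, map_smul, map_smul, map_smul, hq, hp, hqp]
  simp

/-! ### The magnetic symplectic form -/

theorem minSmoothness_two_le : minSmoothness ℝ 2 ≤ ∞ := by
  rw [minSmoothness_of_isRCLikeNormedField]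
  exact WithTop.coe_le_coe.2 le_top

/-- The radial part of the differential is along `p`, hence orthogonal to `q × p`; normalising base
point and vector contributes one factor `1/r` each. -/
theorem IsInvariantPrimitive.pullback_apply {P : Form 1} (hP : IsInvariantPrimitive P) {x v : V}
    (hx : x ∈ cotangent) (h0 : x.2 ≠ 0) (hv : v ∈ tangent x) :
    pullback radialProj P x ![v] = -(⟪cross x.1 x.2, v.2⟫ / ‖x.2‖ ^ 2) := by
  have h : pullback radialProj P x ![v] = P (radialProj x) ![fderiv ℝ radialProj x v] := by
    simp only [pullback, ContinuousAlternatingMap.compContinuousLinearMap_apply]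
    congr 1
    ext1 i
    fin_cases i
    rfl
  rw [h, hP.apply_eq (radialProj_mem_cosphere hx h0) (fderiv_radialProj_mem hx h0 hv),
    fderiv_radialProj h0]
  simp [radialProj, real_inner_smul_left, real_inner_smul_right, inner_sub_right]
  ring

theorem IsInvariantPrimitive.extDeriv_pullback_apply {P : Form 1} (hP : IsInvariantPrimitive P)
    {x v w : V} (hx : x ∈ cotangent) (h0 : x.2 ≠ 0) (hv : v ∈ tangent x) (hw : w ∈ tangent x) :
    extDeriv (pullback radialProj P) x ![v, w] = ⟪cross x.1 v.1, w.1⟫ := by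
  have h1 : ContDiffAt ℝ ∞ radialProj x :=
    contDiffOn_radialProj.contDiffAt (isOpen_snd_ne_zero.mem_nhds h0)
  have h2 : DifferentiableAt ℝ P (radialProj x) := hP.smooth.differentiable (by simp) _
  have h3 : extDeriv (pullback radialProj P) x =
      (extDeriv P (radialProj x)).compContinuousLinearMap (fderiv ℝ radialProj x) :=
    extDeriv_pullback h2 h1 minSmoothness_two_le
  have h4 : (fderiv ℝ radialProj x) ∘ ![v, w] =
      ![fderiv ℝ radialProj x v, fderiv ℝ radialProj x w] := by
    ext1 i
    fin_cases i <;> rfl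
  rw [h3, ContinuousAlternatingMap.compContinuousLinearMap_apply, h4,
    hP.extDeriv_eq _ (radialProj_mem_cosphere hx h0) _ (fderiv_radialProj_mem hx h0 hv) _
      (fderiv_radialProj_mem hx h0 hw), areaForm_apply, fderiv_radialProj h0, fderiv_radialProj h0]
  rfl

theorem contDiffOn_comp_norm {f : ℝ → ℝ} (hf : ContDiff ℝ ∞ f) :
    ContDiffOn ℝ ∞ (fun y : V => f ‖y.2‖) {x : V | x.2 ≠ 0} := fun _ hx =>
  (hf.contDiffAt.comp _ (contDiffAt_norm_snd hx)).contDiffWithinAt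

theorem fderiv_comp_norm {f : ℝ → ℝ} (hf : ContDiff ℝ ∞ f) {x : V} (hx : x.2 ≠ 0) (v : V) :
    fderiv ℝ (fun y : V => f ‖y.2‖) x v = deriv f ‖x.2‖ * (⟪x.2, v.2⟫ / ‖x.2‖) := by
  have h1 := ((contDiffAt_norm_snd hx).differentiableAt (by simp)).hasFDerivAt
  have h2 := (hf.differentiable (by simp) ‖x.2‖).hasDerivAt
  have h3 : HasFDerivAt (fun y : V => f ‖y.2‖) _ x := h2.comp_hasFDerivAt x h1
  rw [h3.fderiv]
  simp [fderiv_norm_snd hx]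

theorem contDiffOn_magneticPrimitive {f : ℝ → ℝ} (hf : ContDiff ℝ ∞ f) {P : Form 1}
    (hP : ContDiff ℝ ∞ P) : ContDiffOn ℝ ∞ (magneticPrimitive f P) {x : V | x.2 ≠ 0} :=
  contDiff_liouvilleForm.contDiffOn.add
    ((contDiffOn_comp_norm hf).smul (contDiffOn_pullback_one isOpen_snd_ne_zero hP
      contDiffOn_radialProj))

/-- The magnetic form in terms of the ambient vector calculus. -/
theorem magneticForm_apply {f : ℝ → ℝ} (hf : ContDiff ℝ ∞ f) (hf0 : f 0 = 1) {P : Form 1}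
    (hP : IsInvariantPrimitive P) {x v w : V} (hx : x ∈ cotangent) (hv : v ∈ tangent x)
    (hw : w ∈ tangent x) :
    magneticForm f P x ![v, w] = ⟪v.2, w.1⟫ - ⟪w.2, v.1⟫ + f ‖x.2‖ * ⟪cross x.1 v.1, w.1⟫ -
      deriv f ‖x.2‖ / ‖x.2‖ ^ 3 * (⟪x.2, v.2⟫ * ⟪cross x.1 x.2, w.2⟫ -
        ⟪x.2, w.2⟫ * ⟪cross x.1 x.2, v.2⟫) := by
  by_cases h0 : x.2 = 0
  · simp only [magneticForm, h0, if_true]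
    rw [ContinuousAlternatingMap.add_apply, extDeriv_liouvilleForm, areaForm_apply]
    simp [hf0]
  · have hnhds := isOpen_snd_ne_zero.mem_nhds h0
    have hn : ‖x.2‖ ≠ 0 := norm_ne_zero_iff.2 h0
    have h1 : DifferentiableAt ℝ (fun y : V => f ‖y.2‖) x :=
      ((contDiffOn_comp_norm hf).contDiffAt hnhds).differentiableAt (by simp)
    have h2 : DifferentiableAt ℝ (pullback radialProj P) x :=
      ((contDiffOn_pullback_one isOpen_snd_ne_zero hP.smooth
        contDiffOn_radialProj).contDiffAt hnhds).differentiableAt (by simp)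
    have h3 : extDeriv (magneticPrimitive f P) x = extDeriv liouvilleForm x +
        extDeriv (fun y => f ‖y.2‖ • pullback radialProj P y) x :=
      extDeriv_fun_add (contDiff_liouvilleForm.differentiable (by simp) x) (h1.smul h2)
    simp only [magneticForm, h0, if_false]
    rw [h3, ContinuousAlternatingMap.add_apply, extDeriv_liouvilleForm,
      extDeriv_smul_function h1 h2, hP.extDeriv_pullback_apply hx h0 hv hw,
      hP.pullback_apply hx h0 hv, hP.pullback_apply hx h0 hw, fderiv_comp_norm hf h0,
      fderiv_comp_norm hf h0]
    field_simp
    ring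

theorem deriv_eq_zero_of_const {f : ℝ → ℝ} {r₀ r : ℝ} (h1 : ∀ r, 0 ≤ r → r ≤ r₀ → f r = 1)
    (hr : 0 < r) (hr' : r < r₀) : deriv f r = 0 := by
  have : f =ᶠ[nhds r] fun _ => 1 := by
    filter_upwards [Ioo_mem_nhds hr hr'] with s hs using h1 s hs.1.le hs.2.le
  rw [this.deriv_eq, deriv_const]

theorem deriv_eq_zero_of_eventually {f : ℝ → ℝ} {r₁ r : ℝ} (h1 : ∀ r, r₁ ≤ r → f r = 0)
    (hr : r₁ < r) : deriv f r = 0 := by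
  have : f =ᶠ[nhds r] fun _ => 0 := by
    filter_upwards [Ioi_mem_nhds hr] with s hs using h1 s hs.le
  rw [this.deriv_eq, deriv_const]

theorem standardAtInfinity_magneticForm {f : ℝ → ℝ} (hf : ContDiff ℝ ∞ f) (hf0 : f 0 = 1)
    {r₁ : ℝ} (h1 : ∀ r, r₁ ≤ r → f r = 0) {P : Form 1} (hP : IsInvariantPrimitive P) :
    StandardAtInfinity (magneticForm f P) := by
  -- The extra `1` gives `r > r₁` strictly, so that `f'` vanishes as well as `f`.
  refine ⟨r₁ + 1, fun x hx hr v hv w hw => ?_⟩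
  rw [magneticForm_apply hf hf0 hP hx hv hw, extDeriv_liouvilleForm, h1 _ (by linarith),
    deriv_eq_zero_of_eventually h1 (by linarith)]
  ring

theorem nondegenerate_magneticForm {f : ℝ → ℝ} (hf : ContDiff ℝ ∞ f) (hf0 : f 0 = 1)
    (hff : ∀ r, 0 < r → 0 < r + f r * deriv f r) {P : Form 1} (hP : IsInvariantPrimitive P)
    {x v : V} (hx : x ∈ cotangent) (hv : v ∈ tangent x)
    (h : ∀ w ∈ tangent x, magneticForm f P x ![v, w] = 0) : v = 0 := by
  have hq : ⟪x.1, x.1⟫ = 1 := by simp [hx.1]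
  have key : ∀ w ∈ tangent x, _ := fun w hw =>
    (magneticForm_apply hf hf0 hP hx hv hw).symm.trans (h w hw)
  by_cases h0 : x.2 = 0
  · have h1 := key (0, v.1) ⟨by simp, by simpa [h0] using hv.1⟩
    simp [h0] at h1
    have h2 := key (v.2, 0) ⟨by simpa [h1] using hv.2, by simp [h0]⟩
    simp [h0, h1] at h2
    exact Prod.ext h1 h2
  · have hn : 0 < ‖x.2‖ := norm_pos_iff.2 h0
    have hp : ⟪x.2, x.2⟫ = ‖x.2‖ ^ 2 := real_inner_self_eq_norm_sq _
    have hqp : ⟪x.1, x.2⟫ = 0 := hx.2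
    have hpq : ⟪x.2, x.1⟫ = 0 := by rw [real_inner_comm, hx.2]
    have hmm : ⟪cross x.1 x.2, cross x.1 x.2⟫ = ‖x.2‖ ^ 2 := by
      rw [inner_cross_cross, hq, hp, hqp]; ring
    have hm : cross x.1 x.2 ≠ 0 := by
      intro hm
      rw [hm, inner_zero_left] at hmm
      exact absurd hmm.symm (pow_pos hn 2).ne'
    have hqv : ⟪x.1, v.1⟫ = 0 := hv.1
    -- These four test vectors frame the tangent space; the term `-r² q` in the third makes it
    -- tangent. The equations split into two `2 × 2` systems, (`k1`, `k4`) and (`k2`, `k3`), each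
    -- invertible because `r + f f' ≠ 0`.
    have k1 := key (0, x.2) ⟨by simp, by simp [hqp]⟩
    have k2 := key (0, cross x.1 x.2) ⟨by simp, by simp⟩
    have k3 := key (x.2, -‖x.2‖ ^ 2 • x.1) ⟨by simp [hqp], by
      simp only [real_inner_smul_right, hq, hp]; ring⟩
    have k4 := key (cross x.1 x.2, 0) ⟨by simp, by simp⟩
    have c1 : ⟪cross x.1 v.1, x.2⟫ = -⟪cross x.1 x.2, v.1⟫ := by
      rw [inner_cross_rotate, inner_cross_rotate, cross_swap, inner_neg_left]
    have c2 : ⟪cross x.1 v.1, cross x.1 x.2⟫ = ⟪x.2, v.1⟫ := by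
      rw [inner_cross_cross, hq, hqp, real_inner_comm]; ring
    simp only [inner_zero_right, inner_zero_left, hp, hmm, c1, c2, inner_self_right_cross,
      inner_cross_self_right, real_inner_smul_right, real_inner_smul_left, hqv, hpq, inner_cross_self_left,
      real_inner_comm x.2 v.2, real_inner_comm (cross x.1 x.2) v.2] at k1 k2 k3 k4
    field_simp at k1 k2
    have hpos := mul_ne_zero (pow_pos hn 2).ne' (hff _ hn).ne'
    have hA : ⟪x.2, v.1⟫ = 0 := by
      have : ‖x.2‖ ^ 2 * (‖x.2‖ + f ‖x.2‖ * deriv f ‖x.2‖) * ⟪x.2, v.1⟫ = 0 := by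
        linear_combination -k1 + ‖x.2‖ ^ 2 * deriv f ‖x.2‖ * k4
      exact (mul_eq_zero.1 this).resolve_left hpos
    have hB : ⟪cross x.1 x.2, v.1⟫ = 0 := by
      have : ‖x.2‖ ^ 2 * (‖x.2‖ + f ‖x.2‖ * deriv f ‖x.2‖) * ⟪cross x.1 x.2, v.1⟫ = 0 := by
        linear_combination -k2 - ‖x.2‖ ^ 2 * deriv f ‖x.2‖ * k3
      exact (mul_eq_zero.1 this).resolve_left hpos
    have hC : ⟪x.2, v.2⟫ = 0 := by linear_combination k3 + f ‖x.2‖ * hB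
    have hD : ⟪cross x.1 x.2, v.2⟫ = 0 := by linear_combination k4 - f ‖x.2‖ * hA
    have hqv2 : ⟪x.1, v.2⟫ = 0 := by
      have := hv.2
      rwa [real_inner_comm, hA, zero_add] at this
    exact Prod.ext (eq_zero_of_inner_eq_zero hm hqv hA hB) (eq_zero_of_inner_eq_zero hm hqv2 hC hD)

theorem isSymplectic_magneticForm {f : ℝ → ℝ} (hf : ContDiff ℝ ∞ f) {r₀ : ℝ} (hr₀ : 0 < r₀)
    (h1 : ∀ r, 0 ≤ r → r ≤ r₀ → f r = 1)
    (hff : ∀ r, 0 < r → 0 < r + f r * deriv f r) {P : Form 1} (hP : IsInvariantPrimitive P) :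
    IsSymplectic (magneticForm f P) where
  nondegenerate x hx v hv h :=
    nondegenerate_magneticForm hf (h1 0 le_rfl hr₀.le) hff hP hx hv h
  smooth_closed := by
    intro x hx
    by_cases h0 : x.2 = 0
    -- On this tube `f` is constantly `1`, so `dλ + π^*σ` represents the magnetic form off the zero
    -- section too.
    · refine ⟨{y : V | ‖y.2‖ < r₀}, isOpen_lt (by fun_prop) (by fun_prop), by simpa [h0] using hr₀,
        fun y => extDeriv liouvilleForm y + areaForm y, ?_, ?_, ?_⟩
      · exact ((contDiff_extDeriv isOpen_univ contDiff_liouvilleForm.contDiffOn).mono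
          (Set.subset_univ _)).add contDiff_areaForm.contDiffOn
      · rintro y ⟨hy, hyr : ‖y.2‖ < r₀⟩ v hv
        have hv2 : v = ![v 0, v 1] := by
          ext1 i
          fin_cases i <;> rfl
        rw [hv2, magneticForm_apply hf (h1 0 le_rfl hr₀.le) hP hy (hv 0) (hv 1),
          ContinuousAlternatingMap.add_apply, extDeriv_liouvilleForm, areaForm_apply,
          h1 _ (norm_nonneg _) hyr.le]
        rcases eq_or_ne y.2 0 with hy0 | hy0
        · simp [hy0]
        · rw [deriv_eq_zero_of_const h1 (norm_pos_iff.2 hy0) hyr]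
          ring
      · rintro y ⟨hy, -⟩ v hv
        have hd : DifferentiableAt ℝ (extDeriv liouvilleForm) y :=
          ((contDiff_extDeriv isOpen_univ contDiff_liouvilleForm.contDiffOn).contDiffAt
            Filter.univ_mem).differentiableAt (by simp)
        rw [extDeriv_fun_add hd (contDiff_areaForm.differentiable (by simp) y),
          ContinuousAlternatingMap.add_apply, extDeriv_areaForm_apply hy v hv,
          extDeriv_extDeriv contDiff_liouvilleForm minSmoothness_two_le]
        simp
    · refine ⟨{y : V | y.2 ≠ 0}, isOpen_snd_ne_zero, h0, extDeriv (magneticPrimitive f P),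
        contDiff_extDeriv isOpen_snd_ne_zero (contDiffOn_magneticPrimitive hf hP.smooth), ?_, ?_⟩
      · rintro y ⟨-, hy : y.2 ≠ 0⟩ v -
        simp [magneticForm, hy]
      · rintro y ⟨-, hy⟩ v -
        rw [extDeriv_extDeriv_apply ((contDiffOn_magneticPrimitive hf hP.smooth).contDiffAt
          (isOpen_snd_ne_zero.mem_nhds hy)) minSmoothness_two_le]
        rfl

/-! ### The Reeb flow -/

/-- The geodesic flow on the unit cosphere bundle, extended linearly. -/
noncomputable def reebFlow (t : ℝ) (x : V) : V :=
  (Real.cos t • x.1 + Real.sin t • x.2, Real.cos t • x.2 - Real.sin t • x.1)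

theorem hasDerivAt_reebFlow (t : ℝ) (x : V) :
    HasDerivAt (fun s => reebFlow s x) ((reebFlow t x).2, -(reebFlow t x).1) t := by
  have hc := Real.hasDerivAt_cos t
  have hs := Real.hasDerivAt_sin t
  refine (((hc.smul_const x.1).fun_add (hs.smul_const x.2)).prodMk
    ((hc.smul_const x.2).fun_sub (hs.smul_const x.1))).congr_deriv ?_
  ext1 <;> simp only [reebFlow] <;> module

theorem reebFlow_mem {x : V} (hx : x ∈ cosphere) (t : ℝ) : reebFlow t x ∈ cosphere := by
  have h11 : ⟪x.1, x.1⟫ = 1 := by simp [hx.1.1]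
  have h22 : ⟪x.2, x.2⟫ = 1 := by simp [hx.2]
  have h12 : ⟪x.1, x.2⟫ = 0 := hx.1.2
  have h21 : ⟪x.2, x.1⟫ = 0 := by rw [real_inner_comm, h12]
  have hone : ∀ a : E3, ⟪a, a⟫ = 1 → ‖a‖ = 1 := by
    intro a ha
    rwa [real_inner_self_eq_norm_sq, pow_eq_one_iff_of_nonneg (norm_nonneg _) two_ne_zero] at ha
  have htrig := Real.sin_sq_add_cos_sq t
  refine ⟨⟨hone _ ?_, ?_⟩, hone _ ?_⟩ <;>
    simp only [reebFlow, inner_add_left, inner_add_right, inner_sub_left, inner_sub_right,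
      real_inner_smul_left, real_inner_smul_right, h11, h22, h12, h21]
  · linear_combination htrig
  · ring
  · linear_combination htrig

theorem reebFlow_add_two_pi (t : ℝ) (x : V) : reebFlow (t + 2 * Real.pi) x = reebFlow t x := by
  simp [reebFlow]

theorem isReebFlow_reebFlow : IsReebFlow reebFlow where
  smooth := by
    refine ContDiff.contDiffOn ?_
    unfold reebFlow
    fun_prop
  mapsTo t x hx := reebFlow_mem hx t
  zero x _ := by simp [reebFlow]
  add s t x _ := by
    ext1 <;> simp only [reebFlow, Real.cos_add, Real.sin_add] <;> module
  form_eq_one t x hx := by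
    rw [(hasDerivAt_reebFlow t x).deriv, liouvilleForm_apply, real_inner_self_eq_norm_sq,
      (reebFlow_mem hx t).2, one_pow]
  mem_ker t x hx v hv := by
    rw [(hasDerivAt_reebFlow t x).deriv, extDeriv_liouvilleForm, inner_neg_left, hv.1.1,
      real_inner_comm, hv.2]
    simp

/-! ### The circle action -/

/-- The moment map `q × p - f(r) q` of the rotation action on the magnetic cotangent bundle. -/
noncomputable def moment (f : ℝ → ℝ) (x : V) : E3 := cross x.1 x.2 - f ‖x.2‖ • x.1

/-- The length `√(r² + f(r)²)` of the moment map. -/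
noncomputable def energy (f : ℝ → ℝ) (x : V) : ℝ := √(‖x.2‖ ^ 2 + f ‖x.2‖ ^ 2)

/-- The normalised moment map. -/
noncomputable def axis (f : ℝ → ℝ) (x : V) : E3 := (energy f x)⁻¹ • moment f x

/-- The rotation about the moment vector. -/
noncomputable def circleAction (f : ℝ → ℝ) (t : ℝ) (x : V) : V :=
  (rot (axis f x) (2 * Real.pi * t) x.1, rot (axis f x) (2 * Real.pi * t) x.2)

section

variable {f : ℝ → ℝ}

theorem energy_arg_pos (hf0 : f 0 = 1) (x : V) : 0 < ‖x.2‖ ^ 2 + f ‖x.2‖ ^ 2 := by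
  rcases eq_or_ne x.2 0 with h | h
  · simp [h, hf0]
  · have := norm_pos_iff.2 h
    positivity

theorem energy_pos (hf0 : f 0 = 1) (x : V) : 0 < energy f x :=
  Real.sqrt_pos.2 (energy_arg_pos hf0 x)

theorem energy_sq (hf0 : f 0 = 1) (x : V) : energy f x ^ 2 = ‖x.2‖ ^ 2 + f ‖x.2‖ ^ 2 :=
  Real.sq_sqrt (energy_arg_pos hf0 x).le

theorem norm_axis (hf0 : f 0 = 1) {x : V} (hx : x ∈ cotangent) : ‖axis f x‖ = 1 := by
  have hN := energy_pos hf0 x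
  have h : ⟪moment f x, moment f x⟫ = energy f x ^ 2 := by
    have hq : ⟪x.1, x.1⟫ = 1 := by simp [hx.1]
    have hp : ⟪x.2, x.2⟫ = ‖x.2‖ ^ 2 := real_inner_self_eq_norm_sq _
    simp only [moment, inner_sub_left, inner_sub_right, real_inner_smul_left,
      real_inner_smul_right, inner_cross_cross, inner_cross_self_left, inner_self_left_cross,
      hq, hp, hx.2, energy_sq hf0]
    ring
  rw [real_inner_self_eq_norm_sq, sq_eq_sq₀ (norm_nonneg _) hN.le] at h
  rw [axis, norm_smul, h, Real.norm_eq_abs, abs_of_pos (inv_pos.2 hN), inv_mul_cancel₀ hN.ne']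

theorem eventually_comp_norm_eq_one {r₀ : ℝ} (hr₀ : 0 < r₀)
    (h1 : ∀ r, 0 ≤ r → r ≤ r₀ → f r = 1) {x : V} (hx : x.2 = 0) :
    (fun y : V => f ‖y.2‖) =ᶠ[nhds x] fun _ => 1 := by
  have : {y : V | ‖y.2‖ < r₀} ∈ nhds x :=
    (isOpen_lt (by fun_prop) (by fun_prop)).mem_nhds (by simpa [hx] using hr₀)
  filter_upwards [this] with y hy using h1 _ (norm_nonneg _) (le_of_lt hy)

/-- The norm is singular only at `p = 0`, and there the composite is locally constant. -/
theorem contDiff_comp_norm (hf : ContDiff ℝ ∞ f) {r₀ : ℝ} (hr₀ : 0 < r₀)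
    (h1 : ∀ r, 0 ≤ r → r ≤ r₀ → f r = 1) : ContDiff ℝ ∞ fun y : V => f ‖y.2‖ := by
  rw [contDiff_iff_contDiffAt]
  intro x
  rcases eq_or_ne x.2 0 with h | h
  · exact contDiffAt_const.congr_of_eventuallyEq (eventually_comp_norm_eq_one hr₀ h1 h)
  · exact (contDiffOn_comp_norm hf).contDiffAt (isOpen_snd_ne_zero.mem_nhds h)

theorem contDiff_energy (hF : ContDiff ℝ ∞ fun y : V => f ‖y.2‖) (hf0 : f 0 = 1) :
    ContDiff ℝ ∞ (energy f) :=
  ((contDiff_snd.norm_sq ℝ).add (hF.pow 2)).sqrt fun x => (energy_arg_pos hf0 x).ne'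

theorem contDiff_axis (hF : ContDiff ℝ ∞ fun y : V => f ‖y.2‖) (hf0 : f 0 = 1) :
    ContDiff ℝ ∞ (axis f) :=
  ((contDiff_energy hF hf0).inv fun x => (energy_pos hf0 x).ne').smul
    ((contDiff_cross contDiff_fst contDiff_snd).sub (hF.smul contDiff_fst))

theorem contDiff_rot {E : Type*} [NormedAddCommGroup E] [NormedSpace ℝ E] {n v : E → E3}
    {θ : E → ℝ} (hn : ContDiff ℝ ∞ n) (hθ : ContDiff ℝ ∞ θ) (hv : ContDiff ℝ ∞ v) :
    ContDiff ℝ ∞ fun x => rot (n x) (θ x) (v x) := by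
  simp only [rot_apply]
  exact ((hθ.cos.smul hv).add (hθ.sin.smul (contDiff_cross hn hv))).add
    (((contDiff_const.sub hθ.cos).mul (hn.inner ℝ hv)).smul hn)

theorem contDiff_circleAction (hF : ContDiff ℝ ∞ fun y : V => f ‖y.2‖) (hf0 : f 0 = 1) :
    ContDiff ℝ ∞ fun z : ℝ × V => circleAction f z.1 z.2 := by
  have hn : ContDiff ℝ ∞ fun z : ℝ × V => axis f z.2 := (contDiff_axis hF hf0).comp contDiff_snd
  have hθ : ContDiff ℝ ∞ fun z : ℝ × V => 2 * Real.pi * z.1 := contDiff_const.mul contDiff_fst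
  exact (contDiff_rot hn hθ (contDiff_fst.comp contDiff_snd)).prodMk
    (contDiff_rot hn hθ (contDiff_snd.comp contDiff_snd))

theorem circleAction_mem (hf0 : f 0 = 1) {x : V} (hx : x ∈ cotangent) (t : ℝ) :
    circleAction f t x ∈ cotangent := by
  have hn := norm_axis hf0 hx
  exact ⟨(norm_rot hn _ _).trans hx.1, (inner_rot_rot hn _ _ _).trans hx.2⟩

/-- The moment map is rotation-equivariant, and a rotation fixes its own axis. This is what makes
the pointwise rotations a group action. -/
theorem axis_circleAction (hf0 : f 0 = 1) {x : V} (hx : x ∈ cotangent) (t : ℝ) :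
    axis f (circleAction f t x) = axis f x := by
  have hn := norm_axis hf0 hx
  have hnorm : ‖(circleAction f t x).2‖ = ‖x.2‖ := norm_rot hn _ _
  have hE : energy f (circleAction f t x) = energy f x := by simp only [energy, hnorm]
  have hM : moment f (circleAction f t x) = rot (axis f x) (2 * Real.pi * t) (moment f x) := by
    simp only [moment, hnorm]
    simp only [circleAction, cross_rot_rot hn, map_sub, map_smul]
  rw [axis, hE, hM, ← map_smul, ← axis, rot_self hn]

theorem circleAction_add (hf0 : f 0 = 1) {x : V} (hx : x ∈ cotangent) (s t : ℝ) :
    circleAction f (s + t) x = circleAction f s (circleAction f t x) := by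
  have hn := norm_axis hf0 hx
  have h : circleAction f s (circleAction f t x) =
      (rot (axis f x) (2 * Real.pi * s) (circleAction f t x).1,
        rot (axis f x) (2 * Real.pi * s) (circleAction f t x).2) := by
    rw [circleAction, axis_circleAction hf0 hx]
  rw [h]
  simp only [circleAction, mul_add, rot_add hn]

theorem circleAction_zero (x : V) : circleAction f 0 x = x := by simp [circleAction]

theorem circleAction_one (x : V) : circleAction f 1 x = x := by simp [circleAction, rot_two_pi]

theorem deriv_circleAction (hf0 : f 0 = 1) {x : V} (hx : x ∈ cotangent) (t : ℝ) :
    deriv (fun s => circleAction f s x) t =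
      infRot ((2 * Real.pi) • axis f (circleAction f t x)) (circleAction f t x) := by
  have hn := norm_axis hf0 hx
  have h1 : ∀ v, HasDerivAt (fun s => rot (axis f x) (2 * Real.pi * s) v)
      ((2 * Real.pi) • cross (axis f x) (rot (axis f x) (2 * Real.pi * t) v)) t := by
    intro v
    have h2 : HasDerivAt (fun s : ℝ => 2 * Real.pi * s) (2 * Real.pi) t := by
      simpa using (hasDerivAt_id t).const_mul (2 * Real.pi)
    exact (hasDerivAt_rot_eq_cross hn (2 * Real.pi * t) v).scomp t h2
  rw [axis_circleAction hf0 hx]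
  refine ((h1 x.1).prodMk (h1 x.2)).deriv.trans ?_
  simp [infRot, circleAction]

theorem fderiv_comp_norm_of_eq_one (hf : ContDiff ℝ ∞ f) {r₀ : ℝ} (hr₀ : 0 < r₀)
    (h1 : ∀ r, 0 ≤ r → r ≤ r₀ → f r = 1) (x v : V) :
    fderiv ℝ (fun y : V => f ‖y.2‖) x v = deriv f ‖x.2‖ * (⟪x.2, v.2⟫ / ‖x.2‖) := by
  rcases eq_or_ne x.2 0 with h | h
  · rw [(eventually_comp_norm_eq_one hr₀ h1 h).fderiv_eq]
    simp [h]
  · exact fderiv_comp_norm hf h v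

theorem fderiv_energy (hf : ContDiff ℝ ∞ f) {r₀ : ℝ} (hr₀ : 0 < r₀)
    (h1 : ∀ r, 0 ≤ r → r ≤ r₀ → f r = 1) (x v : V) :
    fderiv ℝ (energy f) x v =
      (⟪x.2, v.2⟫ + f ‖x.2‖ * (deriv f ‖x.2‖ * (⟪x.2, v.2⟫ / ‖x.2‖))) / energy f x := by
  have hf0 := h1 0 le_rfl hr₀.le
  have hF := contDiff_comp_norm hf hr₀ h1
  have d1 : HasFDerivAt (fun y : V => ‖y.2‖ ^ 2)
      (2 • (innerSL ℝ x.2).comp (ContinuousLinearMap.snd ℝ E3 E3)) x :=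
    hasFDerivAt_snd.norm_sq
  have d2 := (hF.differentiable (by simp) x).hasFDerivAt.pow 2
  have d3 : HasFDerivAt (energy f) _ x := (d1.fun_add d2).sqrt (energy_arg_pos hf0 x).ne'
  rw [d3.fderiv]
  have hN := (energy_pos hf0 x).ne'
  change 1 / (2 * energy f x) * _ = _
  simp [fderiv_comp_norm_of_eq_one hf hr₀ h1]
  field_simp

/-- The magnetic form contracts the infinitesimal rotation about the moment vector to the
differential of its length. -/
theorem magneticForm_infRot (hf : ContDiff ℝ ∞ f) {r₀ : ℝ} (hr₀ : 0 < r₀)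
    (h1 : ∀ r, 0 ≤ r → r ≤ r₀ → f r = 1) {P : Form 1} (hP : IsInvariantPrimitive P) {x v : V}
    (hx : x ∈ cotangent) (hv : v ∈ tangent x) (c : ℝ) :
    magneticForm f P x ![v, infRot (c • axis f x) x] = c * fderiv ℝ (energy f) x v := by
  have hf0 := h1 0 le_rfl hr₀.le
  have hN := (energy_pos hf0 x).ne'
  have hq : ⟪x.1, x.1⟫ = 1 := by simp [hx.1]
  have hp : ⟪x.2, x.2⟫ = ‖x.2‖ ^ 2 := real_inner_self_eq_norm_sq _
  have hqp : ⟪x.1, x.2⟫ = 0 := hx.2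
  have hpq : ⟪x.2, x.1⟫ = 0 := by rw [real_inner_comm, hx.2]
  have hmm : ⟪cross x.1 x.2, cross x.1 x.2⟫ = ‖x.2‖ ^ 2 := by
    rw [inner_cross_cross, hq, hp, hqp]; ring
  -- With `e2`, the generator is a multiple of `(p, -r² q - f q × p)`, a magnetic geodesic field.
  have e1 : cross (c • axis f x) x.1 = (c / energy f x) • x.2 := by
    simp only [axis, moment, map_smul, map_sub, smul_apply, sub_apply, cross_cross_left,
      cross_self_eq_zero, hq, hpq]
    module
  have e2 : cross (c • axis f x) x.2 =
      (-(c / energy f x)) • (‖x.2‖ ^ 2 • x.1 + f ‖x.2‖ • cross x.1 x.2) := by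
    simp only [axis, moment, map_smul, map_sub, smul_apply, sub_apply, cross_cross_left,
      hp, hqp]
    module
  have c1 : ⟪cross x.1 v.1, x.2⟫ = -⟪cross x.1 x.2, v.1⟫ := by
    rw [inner_cross_rotate, inner_cross_rotate, cross_swap, inner_neg_left]
  rw [magneticForm_apply hf hf0 hP hx hv (infRot_mem x _).1, fderiv_energy hf hr₀ h1]
  simp only [infRot, e1, e2, real_inner_smul_left, real_inner_smul_right, inner_add_left,
    inner_add_right, hv.1, hmm, hpq, c1, inner_self_right_cross,
    inner_cross_self_left, real_inner_comm x.2 v.2]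
  rcases eq_or_ne x.2 0 with h0 | h0
  · simp [h0]
  · have hn : ‖x.2‖ ≠ 0 := norm_ne_zero_iff.2 h0
    field_simp
    ring

theorem isGeneratedBy_circleAction (hf : ContDiff ℝ ∞ f) {r₀ : ℝ} (hr₀ : 0 < r₀)
    (h1 : ∀ r, 0 ≤ r → r ≤ r₀ → f r = 1) {P : Form 1} (hP : IsInvariantPrimitive P) :
    IsGeneratedBy (magneticForm f P) (circleAction f)
      fun _ x => 2 * Real.pi * energy f x := by
  intro t x hx v hv
  have hf0 := h1 0 le_rfl hr₀.le
  have hd : DifferentiableAt ℝ (energy f) (circleAction f t x) :=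
    (contDiff_energy (contDiff_comp_norm hf hr₀ h1) hf0).differentiable (by simp) _
  rw [deriv_circleAction hf0 hx, magneticForm_infRot hf hr₀ h1 hP (circleAction_mem hf0 hx t) hv,
    fderiv_const_mul hd]
  simp

theorem isSmoothFamily_circleAction (hF : ContDiff ℝ ∞ fun y : V => f ‖y.2‖) (hf0 : f 0 = 1) :
    IsSmoothFamily (circleAction f) where
  smooth := (contDiff_circleAction hF hf0).contDiffOn
  mapsTo t _ hx := circleAction_mem hf0 hx t
  zero x _ := circleAction_zero x

theorem axis_of_eq_zero {x : V} (h : f ‖x.2‖ = 0) : axis f x = ‖x.2‖⁻¹ • cross x.1 x.2 := by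
  simp [axis, energy, moment, h]

theorem axis_liouvilleFlow {r₁ : ℝ} (h1 : ∀ r, r₁ ≤ r → f r = 0) {x : V} {s : ℝ}
    (hs : r₁ ≤ Real.exp s * ‖x.2‖) :
    axis f (liouvilleFlow s x) = ‖x.2‖⁻¹ • cross x.1 x.2 := by
  have hn : ‖(liouvilleFlow s x).2‖ = Real.exp s * ‖x.2‖ := by
    simp [liouvilleFlow, norm_smul]
  rw [axis_of_eq_zero (by rw [hn]; exact h1 _ hs), hn]
  simp [liouvilleFlow, smul_smul, mul_comm]

/-- Where `f = 0` the axis does not change when `p` is scaled, and rotations are linear; `s ≥ 0`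
keeps the point in that region. -/
theorem isContactAtInfinity_circleAction {r₁ : ℝ} (h1 : ∀ r, r₁ ≤ r → f r = 0) :
    IsContactAtInfinity (circleAction f) := by
  refine ⟨r₁, fun t x _ hr s hs => ?_⟩
  have h2 : r₁ ≤ Real.exp s * ‖x.2‖ := hr.trans
    (le_mul_of_one_le_left (norm_nonneg _) (Real.one_le_exp hs))
  rw [circleAction, axis_liouvilleFlow h1 h2, ← axis_of_eq_zero (h1 _ hr)]
  simp [liouvilleFlow, circleAction]

theorem hasIdealRestriction_circleAction {r₁ : ℝ} (h1 : ∀ r, r₁ ≤ r → f r = 0) :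
    HasIdealRestriction (circleAction f) fun t => reebFlow (2 * Real.pi * t) := by
  -- The threshold `r₁` suffices because `eˢ ≥ s + 1 > r₁`.
  refine ⟨r₁, fun t y hy s hs => ?_⟩
  have hqp : ⟪y.1, y.2⟫ = 0 := hy.1.2
  have hpq : ⟪y.2, y.1⟫ = 0 := by rw [real_inner_comm, hqp]
  have h2 : r₁ ≤ Real.exp s * ‖y.2‖ := by
    rw [hy.2, mul_one]
    linarith [Real.add_one_le_exp s]
  have e1 : rot (cross y.1 y.2) (2 * Real.pi * t) y.1 = (reebFlow (2 * Real.pi * t) y).1 := by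
    simp [rot_apply, reebFlow, cross_cross_left, hy.1.1, hpq]
  have e2 : rot (cross y.1 y.2) (2 * Real.pi * t) y.2 = (reebFlow (2 * Real.pi * t) y).2 := by
    simp [rot_apply, reebFlow, cross_cross_left, hy.2, hqp, sub_eq_add_neg]
  rw [circleAction, axis_liouvilleFlow h1 h2, hy.2, inv_one, one_smul]
  simp only [liouvilleFlow, map_smul, e1, e2]
  simp [radialProj, norm_smul, (reebFlow_mem hy _).2, smul_smul]

theorem isHamiltonianCircleAction_circleAction (hf : ContDiff ℝ ∞ f) {r₀ : ℝ} (hr₀ : 0 < r₀)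
    (h1 : ∀ r, 0 ≤ r → r ≤ r₀ → f r = 1) {P : Form 1} (hP : IsInvariantPrimitive P) :
    IsHamiltonianCircleAction (magneticForm f P) (circleAction f) where
  toIsSmoothFamily :=
    isSmoothFamily_circleAction (contDiff_comp_norm hf hr₀ h1) (h1 0 le_rfl hr₀.le)
  add s t _ hx := circleAction_add (h1 0 le_rfl hr₀.le) hx s t
  one x _ := circleAction_one x
  hamiltonian := ⟨fun x => 2 * Real.pi * energy f x,
    contDiff_const.mul (contDiff_energy (contDiff_comp_norm hf hr₀ h1) (h1 0 le_rfl hr₀.le)),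
    isGeneratedBy_circleAction hf hr₀ h1 hP⟩

end

/-- A Hamiltonian circle action that is contact at infinity is a loop of Hamiltonian
diffeomorphisms of the same kind. -/
theorem IsHamiltonianCircleAction.isContactHamiltonianLoop {Ω : Form 2} {φ : ℝ → V → V}
    (h : IsHamiltonianCircleAction Ω φ) (hc : IsContactAtInfinity φ) :
    IsContactHamiltonianLoop Ω φ where
  toIsSmoothFamily := h.toIsSmoothFamily
  bijOn t := by
    have hinv : ∀ s x, x ∈ cotangent → φ (-s) (φ s x) = x := by
      intro s x hx
      rw [← h.add _ _ x hx, neg_add_cancel, h.zero x hx]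
    refine Set.BijOn.mk (h.mapsTo t) ?_ ?_
    · intro x hx y hy hxy
      rw [← hinv t x hx, ← hinv t y hy]
      exact congrArg _ hxy
    · intro x hx
      exact ⟨φ (-t) x, h.mapsTo _ hx, by simpa using hinv (-t) x hx⟩
  periodic t x hx := by rw [h.add _ _ x hx, h.one x hx]
  hamiltonian := by
    obtain ⟨K, hK, hgen⟩ := h.hamiltonian
    exact ⟨fun _ => K, hK.comp contDiff_snd, hgen⟩
  contactAtInfinity := hc

/-- Below `r₀` the derivative vanishes; from `r₀` on, `f f' > -r₀ ≥ -r`. -/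
theorem add_mul_deriv_pos {f : ℝ → ℝ} {r₀ : ℝ} (h1 : ∀ r, 0 ≤ r → r ≤ r₀ → f r = 1)
    (h2 : ∀ r, 0 ≤ r → -r₀ < f r * deriv f r) {r : ℝ} (hr : 0 < r) :
    0 < r + f r * deriv f r := by
  rcases lt_or_ge r r₀ with h | h
  · simpa [deriv_eq_zero_of_const h1 hr h] using hr
  · linarith [h2 r hr.le]

end MagneticSphere

theorem lemma1p8 :
    (∃ P : MagneticSphere.Form 1, MagneticSphere.IsInvariantPrimitive P) ∧
    ∃ R : ℝ → MagneticSphere.V → MagneticSphere.V,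
      MagneticSphere.IsReebFlow R ∧
      (∀ t, ∀ y ∈ MagneticSphere.cosphere, R (t + 2 * Real.pi) y = R t y) ∧
      ∀ r₀ : ℝ, 0 < r₀ → ∃ δ : ℝ, 0 < δ ∧
        ∀ P : MagneticSphere.Form 1, MagneticSphere.IsInvariantPrimitive P →
        ∀ f : ℝ → ℝ, ContDiff ℝ ∞ f →
          (∀ r, 0 ≤ r → r ≤ r₀ → f r = 1) →
          (∃ r₁ : ℝ, ∀ r, r₁ ≤ r → f r = 0) →
          (∀ r, 0 ≤ r → -δ < f r * deriv f r ∧ f r * deriv f r < δ) →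
          MagneticSphere.IsSymplectic (MagneticSphere.magneticForm f P) ∧
          MagneticSphere.StandardAtInfinity (MagneticSphere.magneticForm f P) ∧
          (∃ φ : ℝ → MagneticSphere.V → MagneticSphere.V,
            MagneticSphere.IsHamiltonianCircleAction (MagneticSphere.magneticForm f P) φ ∧
            MagneticSphere.IsContactAtInfinity φ ∧
            MagneticSphere.HasIdealRestriction φ (fun t => R (2 * Real.pi * t))) ∧
          MagneticSphere.IsExtensible (MagneticSphere.magneticForm f P)
            (fun t => R (2 * Real.pi * t)) := by
  refine ⟨⟨_, MagneticSphere.isInvariantPrimitive_connectionForm⟩, MagneticSphere.reebFlow,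
    MagneticSphere.isReebFlow_reebFlow, fun t y _ => MagneticSphere.reebFlow_add_two_pi t y,
    -- The choice `δ = r₀` is exactly what `add_mul_deriv_pos` needs.
    fun r₀ hr₀ => ⟨r₀, hr₀, ?_⟩⟩
  rintro P hP f hf h1 ⟨r₁, h0⟩ hff
  have hact := MagneticSphere.isHamiltonianCircleAction_circleAction hf hr₀ h1 hP
  have hcont := MagneticSphere.isContactAtInfinity_circleAction h0
  have hideal := MagneticSphere.hasIdealRestriction_circleAction h0
  exact ⟨MagneticSphere.isSymplectic_magneticForm hf hr₀ h1
      (fun _ hr => MagneticSphere.add_mul_deriv_pos h1 (fun r hr' => (hff r hr').1) hr) hP,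
    MagneticSphere.standardAtInfinity_magneticForm hf (h1 0 le_rfl hr₀.le) h0 hP,
    ⟨_, hact, hcont, hideal⟩, ⟨_, hact.isContactHamiltonianLoop hcont, hideal⟩⟩
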